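/- Let $\mathcal H$ be a real Hilbert space, let $f:\mathcal H\to\mathbb R\cup\{+\infty\}$ be proper, convex and lower semicontinuous with $\operatorname{argmin} f\neq\emptyset$, and let $\alpha>1$ and $s_0>0$. Consider the differential inclusion $$\ddot x(s)+\frac{\alpha}{s}\dot x(s)+\partial f\Big(x(s)+\frac{s}{\alpha-1}\dot x(s)\Big)\ni 0,\qquad s\ge s_0,$$ understood through the first-order system, with $y(s)=x(s)+\frac{s}{\alpha-1}\dot x(s)$, $$\dot y(s)+\frac{s}{\alpha-1}\,\partial f(y(s))\ni 0,\qquad \dot x(s)+\frac{\alpha-1}{s}\,(x(s)-y(s))=0 .$$ Let $(x,y)$ be a strong solution of this system on $[s_0,+\infty)$, that is, $x,y:[s_0,+\infty)\to\mathcal H$ are continuous, are absolutely continuous on every compact subinterval of $(s_0,+\infty)$, and for almost every $s>s_0$ are differentiable at $s$ and satisfy the system there. Suppose that $x(s_0)\in\operatorname{dom} f$ and $\dot x(s_0)=0$ (one-sided derivative at $s_0$). Then: (i) $x(s)$ converges weakly, as $s\to+\infty$, to some element of $\operatorname{argmin} f$. (ii) If $\alpha>3$, then $x(s)\in\operatorname{dom}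 f$ and $y(s)\in\operatorname{dom} f$ for all $s\ge s_0$, and $$f(x(s))-\inf_{\mathcal H} f=o\Big(\frac1{s^2}\Big)\quad\text{and}\quad f(y(s))-\inf_{\mathcal H} f=o\Big(\frac1{s^2}\Big)\qquad\text{as } s\to+\infty .$$ -/

import Mathlib

open MeasureTheory Set Filter Topology

/-- `f : H → ℝ ∪ {+∞}` is proper: it never takes the value `-∞` and is not identically `+∞`. -/
def ProperFun {H : Type*} (f : H → EReal) : Prop :=
  (∀ u, f u ≠ ⊥) ∧ ∃ u, f u ≠ ⊤

/-- Convexity of an extended-real-valued function: its epigraph is a convex subset of `H × ℝ`. -/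
def ConvexFun {H : Type*} [AddCommGroup H] [Module ℝ H] (f : H → EReal) : Prop :=
  Convex ℝ {p : H × ℝ | f p.1 ≤ (p.2 : EReal)}

/-- The effective domain `dom f`. -/
def effDom {H : Type*} (f : H → EReal) : Set H :=
  {u | f u < ⊤}

/-- The set of global minimizers `argmin f`. -/
def argminSet {H : Type*} (f : H → EReal) : Set H :=
  {u | ∀ v, f u ≤ f v}

/-- The subdifferential `∂f(u)` of convex analysis. For proper `f` it is empty off `dom f`. -/
def subdiff {H : Type*} [NormedAddCommGroup H] [InnerProductSpace ℝ H]
    (f : H → EReal) (u : H) : Set H :=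
  {ξ | ∀ v, f u + ((inner ℝ ξ (v - u) : ℝ) : EReal) ≤ f v}

/-- Regularity of a strong solution on `[s₀, +∞)`: it is continuous on `[s₀, +∞)` and absolutely
continuous on every compact subinterval of `(s₀, +∞)`. -/
def StrongRegularity {H : Type*} [NormedAddCommGroup H] (s₀ : ℝ) (w : ℝ → H) : Prop :=
  ContinuousOn w (Ici s₀) ∧
    ∀ a b : ℝ, s₀ < a → a ≤ b → AbsolutelyContinuousOnInterval w a b

/-- `(x, y)` is a strong solution on `[s₀, +∞)` of the first-order system
`y' + (s / (α - 1)) ∂f(y) ∋ 0`, `x' + ((α - 1) / s) (x - y) = 0`,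
which is the meaning given to `x'' + (α / s) x' + ∂f (x + (s / (α - 1)) x') ∋ 0`:
both components are absolutely continuous as above and, for almost every `s > s₀`, both are
differentiable at `s` and satisfy the system there. -/
structure IsStrongSolution {H : Type*} [NormedAddCommGroup H] [InnerProductSpace ℝ H]
    (f : H → EReal) (α s₀ : ℝ) (x y : ℝ → H) : Prop where
  regular_x : StrongRegularity s₀ x
  regular_y : StrongRegularity s₀ y
  inclusion : ∀ᵐ s ∂(volume.restrict (Ioi s₀)),
    ∃ y' ξ : H, HasDerivAt y y' s ∧ ξ ∈ subdiff f (y s) ∧ y' + (s / (α - 1)) • ξ = 0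
  averaging : ∀ᵐ s ∂(volume.restrict (Ioi s₀)),
    ∃ x' : H, HasDerivAt x x' s ∧ x' + ((α - 1) / s) • (x s - y s) = 0

/-! The `y`-equation is a subgradient flow in the time `s² / (2(α - 1))`. Integrating `d/ds ‖y - v‖²
≤ 2s/(α - 1) (f v - f y)` gives the evolution variational inequality (`norm_sub_sq_le`), from which
everything about `y` follows: `f ∘ y` is nonincreasing, and `‖y - p‖²` is nonincreasing, hence
convergent, for each minimizer `p`. Comparing times `s/2` and `s` then bounds `s² (f(y s) - min f)`
by a difference that vanishes. Opial's lemma gives a weak limit of `y` in `argmin f`.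

The `x`-equation says `(s^(α-1) x)' = (α-1) s^(α-2) y`. Zero initial velocity means `y s₀ = x s₀`,
so with `y` frozen before `s₀` the position is exactly `x s = ∫₀¹ y(s v^(1/(α-1))) dv`
(`eq_integral`). Dominated convergence transfers the weak limit to `x`. Jensen's inequality
transfers the rate, with dominating function `v^(-2/(α-1))`, integrable on `(0, 1]` exactly when `α
> 3`. -/

/-! ### Absolutely continuous curves. -/

theorem AbsolutelyContinuousOnInterval.norm_comp {F : Type*} [SeminormedAddCommGroup F]
    {f : ℝ → F} {a b : ℝ} (hf : AbsolutelyContinuousOnInterval f a b) :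
    AbsolutelyContinuousOnInterval (fun t => ‖f t‖) a b := by
  unfold AbsolutelyContinuousOnInterval at hf ⊢
  refine squeeze_zero (fun t => Finset.sum_nonneg fun i _ => dist_nonneg) (fun t => ?_) hf
  exact Finset.sum_le_sum fun i _ => by
    simpa only [dist_eq_norm] using dist_norm_norm_le (f (t.2 i).1) (f (t.2 i).2)

/-- An absolutely continuous curve stays absolutely continuous after subtracting a constant. -/
theorem AbsolutelyContinuousOnInterval.sub_const_point {F : Type*} [SeminormedAddCommGroup F]
    {f : ℝ → F} {a b : ℝ} (hf : AbsolutelyContinuousOnInterval f a b) (v : F) :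
    AbsolutelyContinuousOnInterval (fun t => f t - v) a b := by
  unfold AbsolutelyContinuousOnInterval at hf ⊢
  simpa only [dist_sub_right] using hf

theorem AbsolutelyContinuousOnInterval.norm_sub_sq {F : Type*} [SeminormedAddCommGroup F]
    {f : ℝ → F} {a b : ℝ} (hf : AbsolutelyContinuousOnInterval f a b) (v : F) :
    AbsolutelyContinuousOnInterval (fun t => ‖f t - v‖ ^ 2) a b := by
  have h := (hf.sub_const_point v).norm_comp
  simpa only [sq] using h.fun_mul h

theorem AbsolutelyContinuousOnInterval.le_of_ae_hasDerivAt_nonpos {φ : ℝ → ℝ} {a b : ℝ}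
    (hab : a ≤ b) (hφ : AbsolutelyContinuousOnInterval φ a b)
    (hd : ∀ᵐ s, s ∈ Ioo a b → ∃ d ≤ 0, HasDerivAt φ d s) : φ b ≤ φ a := by
  have h := hφ.integral_deriv_eq_sub
  have h0 : ∫ s in a..b, deriv φ s ≤ 0 := by
    rw [intervalIntegral.integral_of_le hab, integral_Ioc_eq_integral_Ioo]
    refine setIntegral_nonpos_of_ae_restrict ?_
    refine (ae_restrict_iff' measurableSet_Ioo).mpr (hd.mono fun s hs hsab => ?_)
    obtain ⟨d, hd0, hds⟩ := hs hsab
    simpa only [hds.deriv, Pi.zero_apply] using hd0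
  linarith

/-! ### Weak limits and Opial's lemma. -/

section WeakLimits

variable {H : Type*} [NormedAddCommGroup H] [InnerProductSpace ℝ H]

/-- Weak compactness of balls: bounded scalars converge along an ultrafilter, the limits are linear
and bounded in `v`, and Riesz representation supplies `q`. -/
theorem exists_weak_limit_of_ultrafilter [CompleteSpace H] {ι : Type*} (𝒰 : Ultrafilter ι)
    (u : ι → H) (R : ℝ) (hR : ∀ᶠ i in (𝒰 : Filter ι), ‖u i‖ ≤ R) :
    ∃ q : H, ∀ v, Tendsto (fun i => inner ℝ (u i) v) 𝒰 (𝓝 (inner ℝ q v)) := by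
  have hex : ∀ v : H, ∃ L : ℝ, L ∈ Icc (-(R * ‖v‖)) (R * ‖v‖) ∧
      Tendsto (fun i => inner ℝ (u i) v) 𝒰 (𝓝 L) := by
    intro v
    have hmem : ∀ᶠ i in (𝒰 : Filter ι), inner ℝ (u i) v ∈ Icc (-(R * ‖v‖)) (R * ‖v‖) := by
      filter_upwards [hR] with i hi
      have h1 := abs_real_inner_le_norm (u i) v
      have h2 : ‖u i‖ * ‖v‖ ≤ R * ‖v‖ := by gcongr
      exact abs_le.mp (h1.trans h2)
    exact isCompact_Icc.ultrafilter_le_nhds (𝒰.map fun i => inner ℝ (u i) v)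
      (le_principal_iff.mpr hmem)
  choose L hLmem hL using hex
  let Λ : H →ₗ[ℝ] ℝ :=
    { toFun := L
      map_add' := fun v w => tendsto_nhds_unique (hL (v + w)) <| by
        simpa only [inner_add_right] using (hL v).add (hL w)
      map_smul' := fun c v => tendsto_nhds_unique (hL (c • v)) <| by
        simpa only [inner_smul_right, smul_eq_mul, RingHom.id_apply] using (hL v).const_mul c }
  refine ⟨(InnerProductSpace.toDual ℝ H).symm
    (Λ.mkContinuous R fun v => abs_le.mpr (hLmem v)), fun v => ?_⟩
  rw [InnerProductSpace.toDual_symm_apply]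
  exact hL v

/-- Opial's lemma, along an arbitrary filter. -/
theorem exists_weak_limit_of_opial [CompleteSpace H] {ι : Type*} {l : Filter ι} [l.NeBot]
    {S : Set H} (hS : S.Nonempty) (u : ι → H)
    (hdist : ∀ p ∈ S, ∃ d : ℝ, Tendsto (fun i => ‖u i - p‖ ^ 2) l (𝓝 d))
    (hcluster : ∀ 𝒰 : Ultrafilter ι, (𝒰 : Filter ι) ≤ l → ∀ q : H,
      (∀ v, Tendsto (fun i => inner ℝ (u i) v) 𝒰 (𝓝 (inner ℝ q v))) → q ∈ S) :
    ∃ p ∈ S, ∀ v, Tendsto (fun i => inner ℝ (u i) v) l (𝓝 (inner ℝ p v)) := by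
  obtain ⟨p₀, hp₀⟩ := hS
  obtain ⟨d₀, hd₀⟩ := hdist p₀ hp₀
  -- Eventually `‖u i - p₀‖² < d₀ + 1`, and `t ≤ t² + 1`.
  have hbdd : ∀ᶠ i in l, ‖u i‖ ≤ ‖p₀‖ + (d₀ + 2) := by
    filter_upwards [hd₀.eventually (gt_mem_nhds (lt_add_one d₀))] with i hi
    have h1 : ‖u i‖ ≤ ‖u i - p₀‖ + ‖p₀‖ := by simpa using norm_add_le (u i - p₀) p₀
    nlinarith [sq_nonneg (‖u i - p₀‖ - 1), sq_nonneg ‖u i - p₀‖, norm_nonneg (u i - p₀)]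
  have hlim : ∀ 𝒰 : Ultrafilter ι, (𝒰 : Filter ι) ≤ l → ∃ q ∈ S,
      ∀ v, Tendsto (fun i => inner ℝ (u i) v) 𝒰 (𝓝 (inner ℝ q v)) := by
    intro 𝒰 h𝒰
    obtain ⟨q, hq⟩ := exists_weak_limit_of_ultrafilter 𝒰 u _ (h𝒰 hbdd)
    exact ⟨q, hcluster 𝒰 h𝒰 q hq, hq⟩
  have hl : ((Ultrafilter.of l : Ultrafilter ι) : Filter ι) ≤ l := Ultrafilter.of_le l
  obtain ⟨p, hpS, hp⟩ := hlim (Ultrafilter.of l) hl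
  refine ⟨p, hpS, fun v => ?_⟩
  rw [tendsto_iff_ultrafilter]
  intro 𝒰 h𝒰
  obtain ⟨q, hqS, hq⟩ := hlim 𝒰 h𝒰
  obtain ⟨dp, hdp⟩ := hdist p hpS
  obtain ⟨dq, hdq⟩ := hdist q hqS
  -- The difference of the two squared distances is affine in `u i`, so this pairing has one limit
  -- along all of `l`; it must equal both `⟪p, p - q⟫` and `⟪q, p - q⟫`.
  have hinner : Tendsto (fun i => inner ℝ (u i) (p - q)) l
      (𝓝 ((dq - dp + (‖p‖ ^ 2 - ‖q‖ ^ 2)) / 2)) := by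
    refine (((hdq.sub hdp).add_const (‖p‖ ^ 2 - ‖q‖ ^ 2)).div_const 2).congr fun i => ?_
    rw [norm_sub_sq_real, norm_sub_sq_real, inner_sub_right]
    ring
  have h1 := tendsto_nhds_unique (hp (p - q)) (hinner.mono_left hl)
  have h2 := tendsto_nhds_unique (hq (p - q)) (hinner.mono_left h𝒰)
  have hpq : p = q := by
    rw [← sub_eq_zero, ← inner_self_eq_zero (𝕜 := ℝ), inner_sub_left, h1, h2, sub_self]
  rw [hpq]
  exact hq v

/-- Mazur: a point outside `C` is strictly separated from it by a continuous functional, which the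
weak limit would violate. -/
theorem mem_of_weak_limit [CompleteSpace H] {ι : Type*} {l : Filter ι} [l.NeBot] {C : Set H}
    (hC : Convex ℝ C) (hCc : IsClosed C) {u : ι → H} (hu : ∀ᶠ i in l, u i ∈ C) {q : H}
    (hq : ∀ v, Tendsto (fun i => inner ℝ (u i) v) l (𝓝 (inner ℝ q v))) : q ∈ C := by
  by_contra hqC
  obtain ⟨g, t, hg, hgq⟩ := geometric_hahn_banach_closed_point hC hCc hqC
  have hrepr : ∀ w, inner ℝ w ((InnerProductSpace.toDual ℝ H).symm g) = g w := fun w => by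
    rw [real_inner_comm, InnerProductSpace.toDual_symm_apply]
  have h := hq ((InnerProductSpace.toDual ℝ H).symm g)
  simp only [hrepr] at h
  exact absurd (le_of_tendsto h (hu.mono fun i hi => (hg _ hi).le)) (not_le.mpr hgq)

theorem tendsto_toWeakSpace_of_inner [CompleteSpace H] {ι : Type*} {l : Filter ι} {u : ι → H}
    {p : H} (h : ∀ v, Tendsto (fun i => inner ℝ (u i) v) l (𝓝 (inner ℝ p v))) :
    Tendsto (fun i => toWeakSpace ℝ H (u i)) l (𝓝 (toWeakSpace ℝ H p)) := by
  have hind : IsInducing fun (z : WeakSpace ℝ H) (g : StrongDual ℝ H) =>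
      (topDualPairing ℝ H).flip z g := ⟨rfl⟩
  refine hind.tendsto_nhds_iff.mpr (tendsto_pi_nhds.mpr fun g => ?_)
  have hrepr : ∀ w, inner ℝ w ((InnerProductSpace.toDual ℝ H).symm g) = g w := fun w => by
    rw [real_inner_comm, InnerProductSpace.toDual_symm_apply]
  have hg := h ((InnerProductSpace.toDual ℝ H).symm g)
  simp only [hrepr] at hg
  exact hg

end WeakLimits

/-! ### The objective gap along `y`. -/

/-- The excess of the objective along the flow, frozen before the initial time. -/
noncomputable def flowGap {H : Type*} (f : H → EReal) (y : ℝ → H) (s₀ m s : ℝ) : ℝ :=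
  (f (y (max s₀ s))).toReal - m

theorem flowGap_nonneg {H : Type*} {f : H → EReal} {y : ℝ → H} {s₀ : ℝ}
    {p : H} (hp : p ∈ argminSet f) {m : ℝ} (hm : f p = m) {s : ℝ}
    (hfin : f (y (max s₀ s)) ≠ ⊤) : 0 ≤ flowGap f y s₀ m s := by
  have h := EReal.toReal_le_toReal (hp (y (max s₀ s))) (hm ▸ EReal.coe_ne_bot m) hfin
  rw [hm, EReal.toReal_coe] at h
  exact sub_nonneg.mpr h

theorem coe_add_flowGap {H : Type*} {f : H → EReal} {y : ℝ → H} {s₀ : ℝ}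
    {p : H} (hp : p ∈ argminSet f) {m : ℝ} (hm : f p = m) {s : ℝ}
    (hfin : f (y (max s₀ s)) ≠ ⊤) :
    ((m + flowGap f y s₀ m s : ℝ) : EReal) = f (y (max s₀ s)) := by
  have hbot : f (y (max s₀ s)) ≠ ⊥ :=
    ((EReal.bot_lt_coe m).trans_le (hm ▸ hp (y (max s₀ s)))).ne'
  rw [flowGap, add_sub_cancel, EReal.coe_toReal hfin hbot]

/-! ### The subgradient flow `y`: variational inequality, decay rate, weak limit. -/

section Flow

variable {H : Type*} [NormedAddCommGroup H] [InnerProductSpace ℝ H]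
variable {f : H → EReal} {α s₀ : ℝ} {x y : ℝ → H}

theorem real_inner_le_of_mem_subdiff {u v ξ : H} (hξ : ξ ∈ subdiff f u) {r c : ℝ}
    (hv : f v ≤ (r : EReal)) (hu : (c : EReal) ≤ f u) : inner ℝ ξ (v - u) ≤ r - c := by
  have h : ((c + inner ℝ ξ (v - u) : ℝ) : EReal) ≤ (r : EReal) := by
    rw [EReal.coe_add]
    exact (add_le_add_left hu _).trans ((hξ v).trans hv)
  have := EReal.coe_le_coe_iff.mp h
  linarith

theorem ConvexFun.convex_sublevel (hconv : ConvexFun f) (c : ℝ) :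
    Convex ℝ {u | f u ≤ (c : EReal)} := by
  intro u hu v hv a b ha hb hab
  have h := hconv (x := (u, c)) hu (y := (v, c)) hv ha hb hab
  have hc : a * c + b * c = c := by rw [← add_mul, hab, one_mul]
  simpa [hc] using h

/-- The integrated evolution variational inequality away from the initial time. -/
theorem IsStrongSolution.norm_sub_sq_le_of_lt (hsol : IsStrongSolution f α s₀ x y) (hα : 1 < α)
    (hs₀ : 0 < s₀) {a b : ℝ} (ha : s₀ < a) (hab : a ≤ b) {v : H} {r c : ℝ}
    (hv : f v ≤ (r : EReal)) (hc : ∀ s ∈ Ioo a b, (c : EReal) ≤ f (y s)) :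
    ‖y b - v‖ ^ 2 + (c - r) / (α - 1) * b ^ 2 ≤ ‖y a - v‖ ^ 2 + (c - r) / (α - 1) * a ^ 2 := by
  have hα' : 0 < α - 1 := sub_pos.mpr hα
  have hAC : AbsolutelyContinuousOnInterval
      (fun s => ‖y s - v‖ ^ 2 + (c - r) / (α - 1) * s ^ 2) a b := by
    refine ((hsol.regular_y.2 a b ha hab).norm_sub_sq v).fun_add ?_
    exact ContDiffOn.absolutelyContinuousOnInterval (by fun_prop)
  refine hAC.le_of_ae_hasDerivAt_nonpos hab ?_
  have hinc := (ae_restrict_iff' measurableSet_Ioi).mp hsol.inclusion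
  filter_upwards [hinc] with s hs hsab
  have hs0 : 0 < s := by linarith [hsab.1]
  obtain ⟨y', ξ, hy', hξ, heq⟩ := hs (ha.trans hsab.1)
  have hy'eq : y' = -((s / (α - 1)) • ξ) := eq_neg_of_add_eq_zero_left heq
  have hin := real_inner_le_of_mem_subdiff hξ hv (hc s hsab)
  refine ⟨2 * inner ℝ (y s - v) y' + (c - r) / (α - 1) * (2 * s), ?_, ?_⟩
  · have hflip : inner ℝ (y s - v) y' = s / (α - 1) * inner ℝ ξ (v - y s) := by
      rw [hy'eq, inner_neg_right, real_inner_smul_right, real_inner_comm, ← neg_sub v,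
        inner_neg_right]
      ring
    have hm := mul_le_mul_of_nonneg_left hin (div_nonneg hs0.le hα'.le)
    rw [hflip]
    have : (c - r) / (α - 1) * (2 * s) = -2 * (s / (α - 1) * (r - c)) := by ring
    linarith
  · have h2 : HasDerivAt (fun s : ℝ => (c - r) / (α - 1) * s ^ 2)
        ((c - r) / (α - 1) * (2 * s)) s := by
      simpa using (hasDerivAt_pow 2 s).const_mul ((c - r) / (α - 1))
    exact (hy'.sub_const v).norm_sq.add h2

/-- The integrated evolution variational inequality. -/
theorem IsStrongSolution.norm_sub_sq_le (hsol : IsStrongSolution f α s₀ x y) (hα : 1 < α)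
    (hs₀ : 0 < s₀) {a b : ℝ} (ha : s₀ ≤ a) (hab : a ≤ b) {v : H} {r c : ℝ}
    (hv : f v ≤ (r : EReal)) (hc : ∀ s ∈ Ioo a b, (c : EReal) ≤ f (y s)) :
    ‖y b - v‖ ^ 2 + (c - r) / (α - 1) * b ^ 2 ≤ ‖y a - v‖ ^ 2 + (c - r) / (α - 1) * a ^ 2 := by
  rcases hab.eq_or_lt with rfl | hlt
  · exact le_rfl
  -- Absolute continuity is only available away from `s₀`, so the case `a = s₀` is reached by
  -- letting `a' ↓ a`.
  have hcont : ContinuousWithinAt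
      (fun s => ‖y s - v‖ ^ 2 + (c - r) / (α - 1) * s ^ 2) (Ioi a) a := by
    have hy : ContinuousWithinAt y (Ioi a) a :=
      (hsol.regular_y.1 a ha).mono fun s hs => ha.trans (mem_Ioi.mp hs).le
    fun_prop
  refine ge_of_tendsto hcont ?_
  filter_upwards [Ioo_mem_nhdsGT hlt] with a' ha'
  exact hsol.norm_sub_sq_le_of_lt hα hs₀ (ha.trans_lt ha'.1) ha'.2.le hv
    fun s hs => hc s ⟨ha'.1.trans hs.1, hs.2⟩

/-- The objective is nonincreasing along the flow. -/
theorem IsStrongSolution.antitoneOn_comp (hsol : IsStrongSolution f α s₀ x y)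
    (hlsc : LowerSemicontinuous f) (hα : 1 < α) (hs₀ : 0 < s₀) :
    AntitoneOn (fun s => f (y s)) (Ici s₀) := by
  intro s hs t _ hst
  by_contra! hlt
  obtain ⟨c, hsc, hct⟩ := EReal.lt_iff_exists_real_btwn.mp hlt
  have hs : s₀ ≤ s := hs
  have hclosed : IsClosed (Icc s t ∩ y ⁻¹' {u | f u ≤ (c : EReal)}) :=
    (hsol.regular_y.1.mono fun r hr => hs.trans hr.1).preimage_isClosed_of_isClosed
      isClosed_Icc (hlsc.isClosed_preimage c)
  have hcompact := isCompact_Icc.of_isClosed_subset hclosed inter_subset_left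
  obtain ⟨r, ⟨hrst, hrc⟩, hrmax⟩ := hcompact.exists_isGreatest ⟨s, ⟨le_rfl, hst⟩, hsc.le⟩
  -- Here `r` is the last time in `[s, t]` with `f (y r) ≤ c`. Afterwards `f ∘ y` exceeds `c`, so
  -- the inequality based at `y r` prevents `y` from moving, contradicting `c < f (y t)`.
  have h := hsol.norm_sub_sq_le hα hs₀ (hs.trans hrst.1) hrst.2 (v := y r) (r := c) (c := c) hrc
    fun q hq => by
      by_contra! hqc
      exact absurd (hrmax ⟨⟨hrst.1.trans hq.1.le, hq.2.le⟩, hqc.le⟩) (not_le.mpr hq.1)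
  have hyt : y t = y r := by
    simp only [sub_self, zero_div, zero_mul, add_zero, norm_zero, ne_eq, OfNat.ofNat_ne_zero,
      not_false_eq_true, zero_pow] at h
    have := pow_eq_zero_iff (two_ne_zero) |>.mp (le_antisymm h (sq_nonneg _))
    exact sub_eq_zero.mp (norm_eq_zero.mp this)
  exact absurd (hrc : f (y r) ≤ c) (not_le.mpr (hyt ▸ hct))

theorem IsStrongSolution.tendsto_norm_sub_sq (hsol : IsStrongSolution f α s₀ x y) (hα : 1 < α)
    (hs₀ : 0 < s₀) {p : H} (hp : p ∈ argminSet f) {m : ℝ} (hm : f p = m) :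
    ∃ d : ℝ, Tendsto (fun s => ‖y s - p‖ ^ 2) atTop (𝓝 d) := by
  have hanti : Antitone fun s => ‖y (max s₀ s) - p‖ ^ 2 := by
    intro a b hab
    have h := hsol.norm_sub_sq_le hα hs₀ (le_max_left s₀ a) (max_le_max_left s₀ hab)
      (v := p) (r := m) (c := m) hm.le fun s _ => hm ▸ hp (y s)
    simpa using h
  refine ⟨_, (tendsto_atTop_ciInf hanti ⟨0, ?_⟩).congr' ?_⟩
  · rintro _ ⟨s, rfl⟩
    positivity
  · filter_upwards [eventually_ge_atTop s₀] with s hs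
    rw [max_eq_right hs]

theorem IsStrongSolution.comp_ne_top (hsol : IsStrongSolution f α s₀ x y)
    (hlsc : LowerSemicontinuous f) (hα : 1 < α) (hs₀ : 0 < s₀) (hdom : f (y s₀) < ⊤) {s : ℝ}
    (hs : s₀ ≤ s) : f (y s) ≠ ⊤ :=
  ((hsol.antitoneOn_comp hlsc hα hs₀ self_mem_Ici hs hs).trans_lt hdom).ne

theorem IsStrongSolution.antitone_flowGap (hsol : IsStrongSolution f α s₀ x y)
    (hα : 1 < α) (hs₀ : 0 < s₀) {p : H} (hp : p ∈ argminSet f) {m : ℝ} (hm : f p = m)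
    (hlsc : LowerSemicontinuous f) (hdom : f (y s₀) < ⊤) : Antitone (flowGap f y s₀ m) := by
  intro s t hst
  have hfin := fun r => hsol.comp_ne_top hlsc hα hs₀ hdom (le_max_left s₀ r)
  have h := hsol.antitoneOn_comp hlsc hα hs₀ (le_max_left s₀ s) (le_max_left s₀ t)
    (max_le_max_left s₀ hst)
  simp only [← coe_add_flowGap hp hm (hfin _), EReal.coe_le_coe_iff] at h
  linarith

/-- On `[s/2, s]` the gap is at least its value at `s`, so the variational inequality bounds `s²`
times that value by a multiple of `‖y(s/2) - p‖² - ‖y(s) - p‖²`; both terms have the same limit. The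
factor `4/3` inverts `1 - 1/4`. -/
theorem IsStrongSolution.tendsto_sq_mul_flowGap (hsol : IsStrongSolution f α s₀ x y)
    (hα : 1 < α) (hs₀ : 0 < s₀) {p : H} (hp : p ∈ argminSet f) {m : ℝ} (hm : f p = m)
    (hlsc : LowerSemicontinuous f) (hdom : f (y s₀) < ⊤) :
    Tendsto (fun s => s ^ 2 * flowGap f y s₀ m s) atTop (𝓝 0) := by
  have hα' : 0 < α - 1 := sub_pos.mpr hα
  obtain ⟨d, hd⟩ := hsol.tendsto_norm_sub_sq hα hs₀ hp hm
  have hhalf : Tendsto (fun s : ℝ => s / 2) atTop atTop := tendsto_id.atTop_div_const two_pos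
  have hdiff : Tendsto (fun s => 4 / 3 * (α - 1) * (‖y (s / 2) - p‖ ^ 2 - ‖y s - p‖ ^ 2)) atTop
      (𝓝 0) := by
    simpa using ((hd.comp hhalf).sub hd).const_mul (4 / 3 * (α - 1))
  refine tendsto_of_tendsto_of_tendsto_of_le_of_le' tendsto_const_nhds hdiff ?_ ?_
  all_goals
    filter_upwards [eventually_ge_atTop (2 * s₀)] with s hs
    have hss : s₀ ≤ s := by linarith
    have hfin : f (y (max s₀ s)) ≠ ⊤ :=
      hsol.comp_ne_top hlsc hα hs₀ hdom (le_max_left s₀ s)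
    have hg := coe_add_flowGap hp hm hfin
    have hg0 := flowGap_nonneg hp hm hfin
    set g := flowGap f y s₀ m s
    rw [max_eq_right hss] at hg
  · exact mul_nonneg (sq_nonneg s) hg0
  · have h := hsol.norm_sub_sq_le hα hs₀ (a := s / 2) (b := s) (by linarith) (by linarith)
      (v := p) (r := m) (c := m + g) hm.le fun q hq => hg ▸
        hsol.antitoneOn_comp hlsc hα hs₀ (mem_Ici.mpr (by linarith [hq.1])) hss hq.2.le
    rw [add_sub_cancel_left] at h
    have h2 : g / (α - 1) * s ^ 2 - g / (α - 1) * (s / 2) ^ 2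
        ≤ ‖y (s / 2) - p‖ ^ 2 - ‖y s - p‖ ^ 2 := by linarith
    calc s ^ 2 * g = 4 / 3 * (α - 1) *
          (g / (α - 1) * s ^ 2 - g / (α - 1) * (s / 2) ^ 2) := by
            field_simp
            ring
      _ ≤ _ := by gcongr

theorem IsStrongSolution.exists_weak_limit [CompleteSpace H] (hsol : IsStrongSolution f α s₀ x y)
    (hα : 1 < α) (hs₀ : 0 < s₀) {p₀ : H} (hp₀ : p₀ ∈ argminSet f) {m : ℝ} (hm : f p₀ = m)
    (hconv : ConvexFun f) (hlsc : LowerSemicontinuous f) (hdom : f (y s₀) < ⊤) :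
    ∃ p ∈ argminSet f, ∀ v, Tendsto (fun s => inner ℝ (y s) v) atTop (𝓝 (inner ℝ p v)) := by
  have hval : ∀ p ∈ argminSet f, f p = m := fun p hp => (le_antisymm (hp p₀) (hp₀ p)).trans hm
  refine exists_weak_limit_of_opial ⟨p₀, hp₀⟩ y
    (fun p hp => hsol.tendsto_norm_sub_sq hα hs₀ hp (hval p hp)) fun 𝒰 h𝒰 q hq v => ?_
  refine le_trans ?_ (hm ▸ hp₀ v : (m : EReal) ≤ f v)
  -- Sublevel sets at each `c > m` are closed and convex, hence weakly closed, and eventually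
  -- contain `y s`.
  refine EReal.le_of_forall_lt_iff_le.mp fun c hc => ?_
  have hc : m < c := EReal.coe_lt_coe_iff.mp hc
  refine mem_of_weak_limit (hconv.convex_sublevel c) (hlsc.isClosed_preimage c)
    (h𝒰 ?_) hq
  have h := hsol.tendsto_sq_mul_flowGap hα hs₀ hp₀ hm hlsc hdom
  filter_upwards [h.eventually (gt_mem_nhds (sub_pos.mpr hc)), eventually_ge_atTop s₀,
    eventually_ge_atTop 1] with s hs hss hs1
  have hfin : f (y (max s₀ s)) ≠ ⊤ :=
    hsol.comp_ne_top hlsc hα hs₀ hdom (le_max_left s₀ s)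
  have hg := coe_add_flowGap hp₀ hm hfin
  have hg0 := flowGap_nonneg hp₀ hm hfin
  rw [max_eq_right hss] at hg
  change f (y s) ≤ c
  rw [← hg, EReal.coe_le_coe_iff]
  nlinarith [mul_nonneg hg0 (sub_nonneg.mpr (one_le_pow₀ hs1 (n := 2)))]

end Flow

/-! ### The position `x` as an average of `y`. -/

theorem StrongRegularity.continuous_comp_max {H : Type*} [NormedAddCommGroup H]
    {s₀ : ℝ} {w : ℝ → H} (hw : StrongRegularity s₀ w) :
    Continuous fun r => w (max s₀ r) :=
  hw.1.comp_continuous (continuous_const.max continuous_id) fun r => le_max_left s₀ r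

section Averaging

variable {H : Type*} [NormedAddCommGroup H] [InnerProductSpace ℝ H]
variable {f : H → EReal} {α s₀ : ℝ} {x y : ℝ → H}

/-- The a.e. derivative of `x` agrees with a continuous function, so `x` differs from a primitive of
it by a constant and the equation holds at every `s > s₀`. -/
theorem IsStrongSolution.hasDerivAt_averaging [CompleteSpace H]
    (hsol : IsStrongSolution f α s₀ x y) (hs₀ : 0 < s₀) {s : ℝ} (hs : s₀ < s) :
    HasDerivAt x (((α - 1) / s) • (y s - x s)) s := by
  let h : ℝ → H := fun r => ((α - 1) / max s₀ r) • (y (max s₀ r) - x (max s₀ r))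
  have hpos : ∀ r, max s₀ r ≠ 0 := fun r => (hs₀.trans_le (le_max_left s₀ r)).ne'
  have hcont : Continuous h :=
    (continuous_const.div (continuous_const.max continuous_id) hpos).smul
      (hsol.regular_y.continuous_comp_max.sub hsol.regular_x.continuous_comp_max)
  have hh : ∀ r, s₀ ≤ r → h r = ((α - 1) / r) • (y r - x r) := fun r hr => by
    simp only [h, max_eq_right hr]
  obtain ⟨a, ha, has⟩ := exists_between hs
  obtain ⟨b, hsb⟩ := exists_gt s
  have hab : a ≤ b := (has.trans hsb).le
  have hprim : ∀ r, HasDerivAt (fun r => ∫ q in a..r, h q) (h r) r := fun r =>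
    hcont.integral_hasStrictDerivAt a r |>.hasDerivAt
  have hAC : AbsolutelyContinuousOnInterval (fun r => x r - ∫ q in a..r, h q) a b := by
    refine (hsol.regular_x.2 a b ha hab).fun_sub
      (ContDiff.contDiffOn ?_).absolutelyContinuousOnInterval
    refine contDiff_one_iff_deriv.mpr ⟨fun r => (hprim r).differentiableAt, ?_⟩
    rwa [show deriv (fun r => ∫ q in a..r, h q) = h from funext fun r => (hprim r).deriv]
  obtain ⟨C, hC⟩ := hAC.const_of_ae_hasDerivAt_zero <| by
    filter_upwards [(ae_restrict_iff' measurableSet_Ioi).mp hsol.averaging] with r hr hrab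
    rw [uIcc_of_le hab] at hrab
    have hr₀ : s₀ < r := ha.trans_le hrab.1
    obtain ⟨x', hx', heq⟩ := hr hr₀
    have hx'h : x' - h r = 0 := by
      rw [hh r hr₀.le, ← heq, ← neg_sub (y r), smul_neg, sub_eq_add_neg]
    exact hx'h ▸ hx'.fun_sub (hprim r)
  have heq : x =ᶠ[𝓝 s] fun r => C + ∫ q in a..r, h q := by
    filter_upwards [Ioo_mem_nhds has hsb] with r hr
    have := hC r (by rw [uIcc_of_le hab]; exact Ioo_subset_Icc_self hr)
    rw [← this, sub_add_cancel]
  rw [← hh s hs.le]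
  exact ((hprim s).const_add C).congr_of_eventuallyEq heq

theorem IsStrongSolution.hasDerivWithinAt_averaging [CompleteSpace H]
    (hsol : IsStrongSolution f α s₀ x y) (hs₀ : 0 < s₀) {s : ℝ} (hs : s₀ ≤ s) :
    HasDerivWithinAt x (((α - 1) / s) • (y s - x s)) (Ici s) s := by
  rcases hs.eq_or_lt with rfl | hlt
  · have hder := fun r (hr : r ∈ Ioi s₀) => hsol.hasDerivAt_averaging hs₀ hr
    refine hasDerivWithinAt_Ici_of_tendsto_deriv (s := Ioi s₀)
      (fun r hr => (hder r hr).differentiableAt.differentiableWithinAt)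
      ((hsol.regular_x.1 s₀ self_mem_Ici).mono Ioi_subset_Ici_self) self_mem_nhdsWithin ?_
    have hx : ContinuousWithinAt x (Ioi s₀) s₀ :=
      (hsol.regular_x.1 s₀ self_mem_Ici).mono Ioi_subset_Ici_self
    have hy : ContinuousWithinAt y (Ioi s₀) s₀ :=
      (hsol.regular_y.1 s₀ self_mem_Ici).mono Ioi_subset_Ici_self
    have hlim : ContinuousWithinAt (fun r => ((α - 1) / r) • (y r - x r)) (Ioi s₀) s₀ :=
      (continuousWithinAt_const.div continuousWithinAt_id hs₀.ne').smul (hy.sub hx)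
    refine hlim.tendsto.congr' ?_
    filter_upwards [self_mem_nhdsWithin] with r hr using (hder r hr).deriv.symm
  · exact (hsol.hasDerivAt_averaging hs₀ hlt).hasDerivWithinAt

theorem IsStrongSolution.eq_of_hasDerivWithinAt_zero [CompleteSpace H]
    (hsol : IsStrongSolution f α s₀ x y) (hα : 1 < α) (hs₀ : 0 < s₀)
    (hx₁ : HasDerivWithinAt x 0 (Ici s₀) s₀) : y s₀ = x s₀ := by
  have h := (uniqueDiffOn_Ici s₀ s₀ self_mem_Ici).eq_deriv _
    (hsol.hasDerivWithinAt_averaging hs₀ le_rfl) hx₁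
  have hne : (α - 1) / s₀ ≠ 0 := (div_pos (sub_pos.mpr hα) hs₀).ne'
  exact sub_eq_zero.mp ((smul_eq_zero.mp h).resolve_left hne)

/-- The position is an average of the values of `y`, frozen before the initial time. -/
theorem IsStrongSolution.eq_integral [CompleteSpace H]
    (hsol : IsStrongSolution f α s₀ x y) (hα : 1 < α) (hs₀ : 0 < s₀)
    (hyx : y s₀ = x s₀) {s : ℝ} (hs : s₀ ≤ s) :
    x s = ∫ v in (0 : ℝ)..1, y (max s₀ (s * v ^ (1 / (α - 1)))) := by
  have hα' : 0 < α - 1 := sub_pos.mpr hα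
  have hβ : 0 < 1 / (α - 1) := one_div_pos.mpr hα'
  have hcont : Continuous fun w : ℝ => y (max s₀ (w ^ (1 / (α - 1)))) :=
    hsol.regular_y.continuous_comp_max.comp (Real.continuous_rpow_const hβ.le)
  -- In the variable `w = r^(α-1)` the averaging weight is uniform, and `r^(α-1) x(r) - F(r^(α-1))`
  -- has zero right derivative.
  let F : ℝ → H := fun T => ∫ w in (0 : ℝ)..T, y (max s₀ (w ^ (1 / (α - 1))))
  have hF : ∀ T, HasDerivAt F (y (max s₀ (T ^ (1 / (α - 1))))) T := fun T =>
    (hcont.integral_hasStrictDerivAt 0 T).hasDerivAt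
  have hpow : ∀ r : ℝ, 0 < r → (r ^ (α - 1)) ^ (1 / (α - 1)) = r := fun r hr => by
    rw [← Real.rpow_mul hr.le, mul_one_div_cancel hα'.ne', Real.rpow_one]
  have hconst : ∀ r ∈ Icc s₀ s, r ^ (α - 1) • x r - F (r ^ (α - 1))
      = s₀ ^ (α - 1) • x s₀ - F (s₀ ^ (α - 1)) := by
    have hder : ∀ r, s₀ ≤ r →
        HasDerivWithinAt (fun r => r ^ (α - 1) • x r - F (r ^ (α - 1))) 0 (Ici r) r := by
      intro r hr
      have hr0 : 0 < r := hs₀.trans_le hr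
      have hp : HasDerivAt (fun r : ℝ => r ^ (α - 1)) ((α - 1) * r ^ (α - 1 - 1)) r :=
        Real.hasDerivAt_rpow_const (Or.inl hr0.ne')
      have hx := hsol.hasDerivWithinAt_averaging hs₀ hr
      have hFr := ((hF (r ^ (α - 1))).scomp r hp).hasDerivWithinAt (s := Ici r)
      rw [hpow r hr0, max_eq_right hr] at hFr
      refine ((hp.hasDerivWithinAt.smul hx).sub hFr).congr_deriv ?_
      rw [Real.rpow_sub_one hr0.ne' (α - 1), smul_smul, smul_sub]
      have e1 : r ^ (α - 1) * ((α - 1) / r) = (α - 1) * (r ^ (α - 1) / r) := by ring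
      rw [e1]
      abel
    refine constant_of_has_deriv_right_zero (fun r hr => ?_) fun r hr => hder r hr.1
    have hr0 : 0 < r := hs₀.trans_le hr.1
    have hp : ContinuousAt (fun r : ℝ => r ^ (α - 1)) r :=
      Real.continuousAt_rpow_const r _ (Or.inl hr0.ne')
    have hx : ContinuousWithinAt x (Icc s₀ s) r :=
      (hsol.regular_x.1 r hr.1).mono Icc_subset_Ici_self
    exact (hp.continuousWithinAt.smul hx).sub
      (((hF _).continuousAt.comp (f := fun r : ℝ => r ^ (α - 1)) hp).continuousWithinAt)
  -- The frozen part of `y` equals `x s₀`, so the constant is zero.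
  have hinit : F (s₀ ^ (α - 1)) = s₀ ^ (α - 1) • x s₀ := by
    have h0 : (0 : ℝ) ≤ s₀ ^ (α - 1) := Real.rpow_nonneg hs₀.le _
    have hle : ∀ w ∈ uIcc 0 (s₀ ^ (α - 1)), y (max s₀ (w ^ (1 / (α - 1)))) = x s₀ := by
      intro w hw
      rw [uIcc_of_le h0] at hw
      have := Real.rpow_le_rpow hw.1 hw.2 hβ.le
      rw [hpow s₀ hs₀] at this
      rw [max_eq_left this, hyx]
    simp only [F]
    rw [intervalIntegral.integral_congr hle, intervalIntegral.integral_const, sub_zero]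
  have hs0 : 0 < s := hs₀.trans_le hs
  have hfin := hconst s ⟨hs, le_rfl⟩
  rw [hinit, sub_self, sub_eq_zero] at hfin
  have hc : s ^ (α - 1) ≠ 0 := (Real.rpow_pos_of_pos hs0 _).ne'
  have hsub := intervalIntegral.integral_comp_mul_left (a := 0) (b := 1)
    (fun w : ℝ => y (max s₀ (w ^ (1 / (α - 1))))) hc
  rw [mul_zero, mul_one] at hsub
  have hcongr : ∫ v in (0 : ℝ)..1, y (max s₀ (s * v ^ (1 / (α - 1))))
      = ∫ v in (0 : ℝ)..1, y (max s₀ ((s ^ (α - 1) * v) ^ (1 / (α - 1)))) := by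
    refine intervalIntegral.integral_congr fun v hv => ?_
    rw [uIcc_of_le zero_le_one] at hv
    simp only [Real.mul_rpow (Real.rpow_nonneg hs0.le _) hv.1, hpow s hs0]
  rw [hcongr, hsub]
  exact (eq_inv_smul_iff₀ hc).mpr hfin

theorem tendsto_mul_rpow_atTop {v β : ℝ} (hv : 0 < v) :
    Tendsto (fun s : ℝ => s * v ^ β) atTop atTop :=
  tendsto_id.atTop_mul_const (Real.rpow_pos_of_pos hv β)

theorem IsStrongSolution.exists_norm_le (hsol : IsStrongSolution f α s₀ x y) (hα : 1 < α)
    (hs₀ : 0 < s₀) {p : H} (hp : p ∈ argminSet f) {m : ℝ} (hm : f p = m) :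
    ∃ M, ∀ r, ‖y (max s₀ r)‖ ≤ M := by
  refine ⟨‖y s₀ - p‖ + ‖p‖, fun r => ?_⟩
  have h := hsol.norm_sub_sq_le hα hs₀ le_rfl (le_max_left s₀ r)
    (v := p) (r := m) (c := m) hm.le fun s _ => hm ▸ hp (y s)
  simp only [sub_self, zero_div, zero_mul, add_zero] at h
  have h1 : ‖y (max s₀ r) - p‖ ≤ ‖y s₀ - p‖ := (sq_le_sq₀ (norm_nonneg _) (norm_nonneg _)).mp h
  have h2 : ‖y (max s₀ r)‖ ≤ ‖y (max s₀ r) - p‖ + ‖p‖ := by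
    simpa using norm_add_le (y (max s₀ r) - p) p
  linarith

theorem IsStrongSolution.continuous_rescaled (hsol : IsStrongSolution f α s₀ x y) (hα : 1 < α)
    (s : ℝ) : Continuous fun v : ℝ => y (max s₀ (s * v ^ (1 / (α - 1)))) :=
  hsol.regular_y.continuous_comp_max.comp
    (continuous_const.mul (Real.continuous_rpow_const (one_div_pos.mpr (sub_pos.mpr hα)).le))

theorem IsStrongSolution.tendsto_inner_averaging [CompleteSpace H]
    (hsol : IsStrongSolution f α s₀ x y) (hα : 1 < α) (hs₀ : 0 < s₀) (hyx : y s₀ = x s₀)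
    {M : ℝ} (hM : ∀ r, ‖y (max s₀ r)‖ ≤ M) {p w : H}
    (hy : Tendsto (fun s => inner ℝ (y s) w) atTop (𝓝 (inner ℝ p w))) :
    Tendsto (fun s => inner ℝ (x s) w) atTop (𝓝 (inner ℝ p w)) := by
  have hy' : Tendsto (fun s => inner ℝ (y (max s₀ s)) w) atTop (𝓝 (inner ℝ p w)) :=
    hy.congr' <| by
      filter_upwards [eventually_ge_atTop s₀] with s hs
      rw [max_eq_right hs]
  have hlim : Tendsto
      (fun s => ∫ v in (0 : ℝ)..1, inner ℝ (y (max s₀ (s * v ^ (1 / (α - 1))))) w) atTop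
      (𝓝 (∫ _ in (0 : ℝ)..1, inner ℝ p w)) := by
    refine intervalIntegral.tendsto_integral_filter_of_dominated_convergence
      (fun _ => M * ‖w‖) ?_ ?_ intervalIntegrable_const ?_
    · exact .of_forall fun s =>
        ((hsol.continuous_rescaled hα s).inner continuous_const).aestronglyMeasurable
    · refine .of_forall fun s => .of_forall fun v _ => (norm_inner_le_norm _ _).trans ?_
      gcongr
      exact hM _
    · refine .of_forall fun v hv => hy'.comp (tendsto_mul_rpow_atTop ?_)
      rw [uIoc_of_le zero_le_one] at hv
      exact hv.1
  rw [intervalIntegral.integral_const, sub_zero, one_smul] at hlim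
  refine hlim.congr' ?_
  filter_upwards [eventually_ge_atTop s₀] with s hs
  rw [hsol.eq_integral hα hs₀ hyx hs, real_inner_comm]
  have := (innerSL ℝ w).intervalIntegral_comp_comm
    ((hsol.continuous_rescaled hα s).intervalIntegrable (μ := volume) 0 1)
  simp only [innerSL_apply_apply] at this
  rw [← this]
  simp only [real_inner_comm]

theorem IsStrongSolution.antitoneOn_rescaled_flowGap (hsol : IsStrongSolution f α s₀ x y)
    (hα : 1 < α) (hs₀ : 0 < s₀) {p : H} (hp : p ∈ argminSet f) {m : ℝ} (hm : f p = m)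
    (hlsc : LowerSemicontinuous f) (hdom : f (y s₀) < ⊤) {s : ℝ} (hs : 0 ≤ s) :
    AntitoneOn (fun v : ℝ => flowGap f y s₀ m (s * v ^ (1 / (α - 1)))) (Icc 0 1) := by
  intro v hv w _ hvw
  have hβ : 0 ≤ 1 / (α - 1) := (one_div_pos.mpr (sub_pos.mpr hα)).le
  exact hsol.antitone_flowGap hα hs₀ hp hm hlsc hdom
    (mul_le_mul_of_nonneg_left (Real.rpow_le_rpow hv.1 hvw hβ) hs)

/-- Jensen's inequality for the averaged trajectory. -/
theorem IsStrongSolution.apply_averaging_le [CompleteSpace H]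
    (hsol : IsStrongSolution f α s₀ x y) (hα : 1 < α) (hs₀ : 0 < s₀) (hyx : y s₀ = x s₀)
    {p : H} (hp : p ∈ argminSet f) {m : ℝ} (hm : f p = m)
    (hconv : ConvexFun f) (hlsc : LowerSemicontinuous f) (hdom : f (y s₀) < ⊤)
    {s : ℝ} (hs : s₀ ≤ s) :
    f (x s) ≤ ((m + ∫ v in Ioc (0 : ℝ) 1, flowGap f y s₀ m (s * v ^ (1 / (α - 1))) : ℝ) :
      EReal) := by
  -- Jensen is applied as: the mean of a curve in the closed convex epigraph stays in it.
  have hclosed : IsClosed {q : H × ℝ | f q.1 ≤ (q.2 : EReal)} :=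
    hlsc.isClosed_epigraph.preimage
      (continuous_fst.prodMk (continuous_coe_real_ereal.comp continuous_snd))
  have : IsProbabilityMeasure (volume.restrict (Ioc (0 : ℝ) 1)) :=
    ⟨by simp⟩
  have hint1 : Integrable (fun v : ℝ => y (max s₀ (s * v ^ (1 / (α - 1)))))
      (volume.restrict (Ioc 0 1)) :=
    ((hsol.continuous_rescaled hα s).intervalIntegrable 0 1).1
  have hint2 : Integrable (fun v : ℝ => flowGap f y s₀ m (s * v ^ (1 / (α - 1))))
      (volume.restrict (Ioc 0 1)) :=
    ((hsol.antitoneOn_rescaled_flowGap hα hs₀ hp hm hlsc hdom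
      (hs₀.le.trans hs)).integrableOn_isCompact isCompact_Icc).mono_set Ioc_subset_Icc_self
  have hint3 := (integrable_const (μ := volume.restrict (Ioc (0 : ℝ) 1)) m).add hint2
  have h := Convex.integral_mem hconv hclosed (μ := volume.restrict (Ioc (0 : ℝ) 1))
    (f := fun v => (y (max s₀ (s * v ^ (1 / (α - 1)))),
      m + flowGap f y s₀ m (s * v ^ (1 / (α - 1)))))
    (.of_forall fun v => (coe_add_flowGap hp hm
      (hsol.comp_ne_top hlsc hα hs₀ hdom (le_max_left _ _))).ge) (hint1.prodMk hint3)
  have hpair := integral_pair hint1 hint3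
  simp only [Pi.add_apply] at hpair
  rw [hpair, integral_add (integrable_const m) hint2, integral_const] at h
  rw [hsol.eq_integral hα hs₀ hyx hs, intervalIntegral.integral_of_le zero_le_one]
  simpa using h

theorem IsStrongSolution.tendsto_sq_mul_integral_flowGap
    (hsol : IsStrongSolution f α s₀ x y) (hα : 3 < α) (hs₀ : 0 < s₀)
    {p : H} (hp : p ∈ argminSet f) {m : ℝ} (hm : f p = m)
    (hlsc : LowerSemicontinuous f) (hdom : f (y s₀) < ⊤) :
    Tendsto (fun s : ℝ =>
      s ^ 2 * ∫ v in Ioc (0 : ℝ) 1, flowGap f y s₀ m (s * v ^ (1 / (α - 1)))) atTop (𝓝 0) := by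
  have hα1 : 1 < α := by linarith
  have hα' : 0 < α - 1 := by linarith
  have hanti := hsol.antitone_flowGap hα1 hs₀ hp hm hlsc hdom
  have hnonneg : ∀ r, 0 ≤ flowGap f y s₀ m r := fun r =>
    flowGap_nonneg hp hm (hsol.comp_ne_top hlsc hα1 hs₀ hdom (le_max_left _ _))
  have hlim := hsol.tendsto_sq_mul_flowGap hα1 hs₀ hp hm hlsc hdom
  -- Large `r` is controlled by the limit, bounded `r` by monotonicity, the frozen gap at `0` being
  -- the largest on `r ≥ 0`.
  obtain ⟨K, hK⟩ : ∃ K, ∀ r, 0 ≤ r → r ^ 2 * flowGap f y s₀ m r ≤ K := by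
    obtain ⟨R, hR⟩ := eventually_atTop.mp (hlim.eventually (gt_mem_nhds one_pos))
    refine ⟨max 1 (R ^ 2 * flowGap f y s₀ m 0), fun r hr => ?_⟩
    rcases le_total R r with h | h
    · exact (hR r h).le.trans (le_max_left _ _)
    · refine le_trans ?_ (le_max_right _ _)
      exact mul_le_mul (pow_le_pow_left₀ hr h 2) (hanti hr) (hnonneg r) (sq_nonneg R)
  have hdom' : Tendsto (fun s : ℝ =>
      ∫ v in Ioc (0 : ℝ) 1, s ^ 2 * flowGap f y s₀ m (s * v ^ (1 / (α - 1)))) atTop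
      (𝓝 (∫ _ in Ioc (0 : ℝ) 1, (0 : ℝ))) := by
    have hsq : ∀ {v : ℝ} (s : ℝ), 0 < v → s ^ 2 * flowGap f y s₀ m (s * v ^ (1 / (α - 1))) =
        v ^ (-2 / (α - 1)) * ((s * v ^ (1 / (α - 1))) ^ 2 *
          flowGap f y s₀ m (s * v ^ (1 / (α - 1)))) := by
      intro v s hv
      have h1 : v ^ (-2 / (α - 1)) * (v ^ (1 / (α - 1))) ^ 2 = 1 := by
        rw [← Real.rpow_natCast, ← Real.rpow_mul hv.le, ← Real.rpow_add hv]
        convert Real.rpow_zero v using 2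
        push_cast
        ring
      linear_combination -(s ^ 2 * flowGap f y s₀ m (s * v ^ (1 / (α - 1)))) * h1
    refine tendsto_integral_filter_of_dominated_convergence
      (fun v : ℝ => v ^ (-2 / (α - 1)) * K) ?_ ?_ ?_ ?_
    · filter_upwards [eventually_ge_atTop 0] with s hs
      exact ((((hsol.antitoneOn_rescaled_flowGap hα1 hs₀ hp hm hlsc hdom
        hs).integrableOn_isCompact isCompact_Icc).mono_set
          Ioc_subset_Icc_self).const_mul _).aestronglyMeasurable
    · filter_upwards [eventually_ge_atTop 0] with s hs
      refine (ae_restrict_iff' measurableSet_Ioc).mpr (.of_forall fun v hv => ?_)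
      rw [Real.norm_of_nonneg (mul_nonneg (sq_nonneg s) (hnonneg _)), hsq s hv.1]
      have := Real.rpow_nonneg hv.1.le (-2 / (α - 1))
      gcongr
      exact hK _ (mul_nonneg hs (Real.rpow_nonneg hv.1.le _))
    -- The only use of `α > 3` beyond `α > 1`.
    · have hexp : -1 < -2 / (α - 1) := by
        rw [lt_div_iff₀ hα']
        linarith
      exact ((intervalIntegral.intervalIntegrable_rpow' hexp (a := 0) (b := 1)).1).mul_const K
    · refine (ae_restrict_iff' measurableSet_Ioc).mpr (.of_forall fun v hv => ?_)
      have h := ((hlim.comp (tendsto_mul_rpow_atTop (β := 1 / (α - 1)) hv.1)).const_mul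
        (v ^ (-2 / (α - 1))))
      rw [mul_zero] at h
      exact h.congr fun s => (hsq s hv.1).symm
  simpa only [integral_const_mul, integral_zero] using hdom'

end Averaging

/-! ### Conclusion. -/

theorem isLittleO_one_div_sq {g : ℝ → ℝ} (h : Tendsto (fun s => s ^ 2 * g s) atTop (𝓝 0)) :
    g =o[atTop] fun s : ℝ => 1 / s ^ 2 := by
  refine (Asymptotics.isLittleO_iff_tendsto' ?_).mpr (h.congr fun s => ?_)
  · filter_upwards [eventually_gt_atTop 0] with s hs h0
    exact absurd h0 (by positivity)
  · rw [div_div_eq_mul_div, div_one, mul_comm]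

theorem mainTheorem7 {H : Type*} [NormedAddCommGroup H] [InnerProductSpace ℝ H] [CompleteSpace H]
    (f : H → EReal) (hproper : ProperFun f) (hconv : ConvexFun f) (hlsc : LowerSemicontinuous f)
    (hargmin : (argminSet f).Nonempty)
    (α s₀ : ℝ) (hα : 1 < α) (hs₀ : 0 < s₀)
    (x y : ℝ → H) (hsol : IsStrongSolution f α s₀ x y)
    (hx₀ : x s₀ ∈ effDom f) (hx₁ : HasDerivWithinAt x 0 (Ici s₀) s₀) :
    (∃ p ∈ argminSet f,
      Tendsto (fun s => toWeakSpace ℝ H (x s)) atTop (𝓝 (toWeakSpace ℝ H p))) ∧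
    (3 < α →
      ((∀ s, s₀ ≤ s → x s ∈ effDom f) ∧
        (fun s => (f (x s)).toReal - (⨅ z, f z).toReal) =o[atTop] fun s : ℝ => 1 / s ^ 2) ∧
      ((∀ s, s₀ ≤ s → y s ∈ effDom f) ∧
        (fun s => (f (y s)).toReal - (⨅ z, f z).toReal) =o[atTop] fun s : ℝ => 1 / s ^ 2)) := by
  obtain ⟨p₀, hp₀⟩ := hargmin
  obtain ⟨hbot, u, hu⟩ := hproper
  have hm : f p₀ = ((f p₀).toReal : EReal) :=
    (EReal.coe_toReal ((hp₀ u).trans_lt (lt_top_iff_ne_top.mpr hu)).ne (hbot p₀)).symm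
  have hinf : ⨅ z, f z = f p₀ := le_antisymm (iInf_le f p₀) (le_iInf hp₀)
  rw [hinf]
  set m := (f p₀).toReal
  have hyx := hsol.eq_of_hasDerivWithinAt_zero hα hs₀ hx₁
  have hdom : f (y s₀) < ⊤ := hyx ▸ hx₀
  refine ⟨?_, fun hα3 => ⟨?_, ?_⟩⟩
  · obtain ⟨p, hp, hlim⟩ := hsol.exists_weak_limit hα hs₀ hp₀ hm hconv hlsc hdom
    obtain ⟨M, hM⟩ := hsol.exists_norm_le hα hs₀ hp₀ hm
    exact ⟨p, hp, tendsto_toWeakSpace_of_inner fun w =>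
      hsol.tendsto_inner_averaging hα hs₀ hyx hM (hlim w)⟩
  · have hle := fun s (hs : s₀ ≤ s) =>
      hsol.apply_averaging_le hα hs₀ hyx hp₀ hm hconv hlsc hdom hs
    refine ⟨fun s hs => (hle s hs).trans_lt (EReal.coe_lt_top _), isLittleO_one_div_sq ?_⟩
    refine tendsto_of_tendsto_of_tendsto_of_le_of_le' tendsto_const_nhds
      (hsol.tendsto_sq_mul_integral_flowGap hα3 hs₀ hp₀ hm hlsc hdom) ?_ ?_
    all_goals filter_upwards [eventually_ge_atTop s₀] with s hs
    · have h := EReal.toReal_le_toReal (hp₀ (x s)) (hbot p₀)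
        ((hle s hs).trans_lt (EReal.coe_lt_top _)).ne
      exact mul_nonneg (sq_nonneg s) (sub_nonneg.mpr h)
    · have h := EReal.toReal_le_toReal (hle s hs) (hbot _) (EReal.coe_ne_top _)
      rw [EReal.toReal_coe] at h
      gcongr
      linarith
  · refine ⟨fun s hs => lt_top_iff_ne_top.mpr (hsol.comp_ne_top hlsc hα hs₀ hdom hs),
      isLittleO_one_div_sq ?_⟩
    refine (hsol.tendsto_sq_mul_flowGap hα hs₀ hp₀ hm hlsc hdom).congr' ?_
    filter_upwards [eventually_ge_atTop s₀] with s hs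
    rw [flowGap, max_eq_right hs]
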